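/- **Setting.** Let $\mathbb X=\mathbb R^n$, let $\mathbb U$ be a compact metric space, and let $\mathcal T(dy\mid x,u)$ be a stochastic (Borel transition probability) kernel from $\mathbb X\times\mathbb U$ to $\mathbb X$; all actions are admissible in every state. A *stationary policy* is a stochastic kernel $\gamma(du\mid x)$ from $\mathbb X$ to $\mathbb U$; $\Gamma_S$ is the set of all of them. Put $\mathcal T^\gamma(A\mid x)=\int\mathcal T(A\mid x,u)\,\gamma(du\mid x)$; a probability measure $\pi$ on $\mathbb X$ is *invariant under $\gamma$* if $\pi(A)=\int\mathcal T^\gamma(A\mid x)\,\pi(dx)$ for all Borel $A$. Let $\mathcal G$ be the set of Borel probability measures $\mu$ on $\mathbb X\times\mathbb U$ with $\mu(B\times\mathbb U)=\int\mathcal T(B\mid x,u)\,\mu(dx,du)$ for all Borel $B\subseteq\mathbb X$. Let $\psi$ be a $\sigma$-finite Borel measure on $\mathbb X$. The *Young topology at input $\psi$* on $\Gamma_S$ is the coarsest topology for which $$\gamma\longmapsto\int\psi(dx)\int\gamma(du\mid x)\,g(x,u)$$ is continuous for every bounded continuous $g:\mathbb X\times\mathbb U\to\mathbb R$ with $\int\sup_u|g(x,u)|\,\psi(dx)<\infty$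 (the last condition is automatic if $\psi$ is finite). **Theorem 4.1.** Suppose that: 1. every stationary policy $\gamma\in\Gamma_S$ has a unique invariant probability measure $\pi_\gamma$; 2. for all $(x,u)$, $\mathcal T(dy\mid x,u)=f_{x,u}(y)\,\psi(dy)$ with densities $f_{x,u}:\mathbb X\to[0,\infty)$, each of which is bounded, and the family $\{f_{x,u}:x\in\mathbb X,\,u\in\mathbb U\}$ is equicontinuous (at every point of $\mathbb X$); 3. one of the following holds: - (a) (H1): $(x,u)\mapsto\int f(z)\,\mathcal T(dz\mid x,u)$ is continuous for every bounded continuous $f:\mathbb X\to\mathbb R$; and $\mathcal G$ is compact in the topology of weak convergence; or - (b) (H2): for every $x\in\mathbb X$ and every bounded measurable $f:\mathbb X\to\mathbb R$ the map $u\mapsto\int f(z)\,\mathcal T(dz\mid x,u)$ is continuous, and there is a finite measure $\nu$ on $\mathbb X$ with $\mathcal T(\cdot\mid x,u)\le\nu$ for all $(x,u)$. Then the map $\gamma\mapsto\pi_\gamma$ on $\Gamma_S$, endowed with the Young topology at input $\psi$, is continuous both for the topology of weak convergence of probability measures on $\mathbb X$ and in total variation, that is, $\|\pi_{\gamma'}-\pi_\gamma\|_{TV}\to0$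 as $\gamma'\to\gamma$, for every $\gamma\in\Gamma_S$. -/

import Mathlib

open MeasureTheory ProbabilityTheory Topology Filter Set
open scoped ENNReal NNReal BoundedContinuousFunction

/-- Stationary (randomized Markov) policies: stochastic kernels from the state space `X` to the
action space `U`, every action being admissible at every state. -/
abbrev StationaryPolicy (X U : Type*) [MeasurableSpace X] [MeasurableSpace U] : Type _ :=
  {γ : Kernel X U // IsMarkovKernel γ}

/-- The transition kernel under a stationary policy,
`T^γ(A | x) = ∫ T(A | x, u) γ(du | x)`. -/
noncomputable def closedLoop {X U : Type*} [MeasurableSpace X] [MeasurableSpace U]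
    (T : Kernel (X × U) X) (γ : StationaryPolicy X U) : Kernel X X :=
  T ∘ₖ (Kernel.id ×ₖ γ.1)

/-- Every stationary policy has a unique invariant probability measure. -/
def UniquelyInvariant {X U : Type*} [MeasurableSpace X] [MeasurableSpace U]
    (T : Kernel (X × U) X) : Prop :=
  ∀ γ : StationaryPolicy X U,
    ∃! p : ProbabilityMeasure X, Kernel.Invariant (closedLoop T γ) (p : Measure X)

/-- The invariant probability measure of the chain under the policy `γ`. -/
noncomputable def invariantMeasure {X U : Type*} [MeasurableSpace X] [MeasurableSpace U]
    (T : Kernel (X × U) X) (hT : UniquelyInvariant T) (γ : StationaryPolicy X U) :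
    ProbabilityMeasure X :=
  (hT γ).exists.choose

/-- The set of invariant occupation measures: probability measures `μ` on `X × U` with
`μ(B × U) = ∫ T(B | x, u) μ(dx, du)` for all Borel sets `B`. -/
def invariantOccupationMeasures {X U : Type*} [MeasurableSpace X] [MeasurableSpace U]
    (T : Kernel (X × U) X) : Set (ProbabilityMeasure (X × U)) :=
  {μ | ∀ B : Set X, MeasurableSet B →
    (μ : Measure (X × U)) (B ×ˢ univ) = ∫⁻ p, T p B ∂(μ : Measure (X × U))}

/-- Weak continuity of the transition kernel in the state-action pair. -/
def WeaklyContinuousKernel {X U : Type*} [TopologicalSpace X] [TopologicalSpace U]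
    [MeasurableSpace X] [MeasurableSpace U] (T : Kernel (X × U) X) : Prop :=
  ∀ f : X →ᵇ ℝ, Continuous fun p : X × U => ∫ z, f z ∂(T p)

/-- Strong (setwise) continuity of the transition kernel in the action, for each state. -/
def StronglyContinuousInAction {X U : Type*} [TopologicalSpace U]
    [MeasurableSpace X] [MeasurableSpace U] (T : Kernel (X × U) X) : Prop :=
  ∀ x : X, ∀ f : X → ℝ, Measurable f → (∃ C : ℝ, ∀ z, |f z| ≤ C) →
    Continuous fun u : U => ∫ z, f z ∂(T (x, u))

/-- The transition kernel is majorized by a finite measure. -/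
def MajorizedKernel {X U : Type*} [MeasurableSpace X] [MeasurableSpace U]
    (T : Kernel (X × U) X) : Prop :=
  ∃ ν : Measure X, IsFiniteMeasure ν ∧ ∀ x u, T (x, u) ≤ ν

/-- The transition probabilities `T(dy | x, u)` have densities `f x u` with respect to `ψ`,
each of which is bounded, and which form an equicontinuous family. -/
def HasBoundedEquicontinuousDensities {X U : Type*} [TopologicalSpace X]
    [MeasurableSpace X] [MeasurableSpace U] (T : Kernel (X × U) X) (ψ : Measure X) : Prop :=
  ∃ f : X → U → X → ℝ≥0,
    (∀ x u, T (x, u) = ψ.withDensity fun y => (f x u y : ℝ≥0∞)) ∧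
    (∀ x u, ∃ C : ℝ≥0, ∀ y, f x u y ≤ C) ∧
    Equicontinuous fun p : X × U => f p.1 p.2

/-- The test functions of the Young topology at input `ψ`: bounded continuous `g` on `X × U`
with `∫ sup_u |g(x, u)| ψ(dx) < ∞`. If `ψ` is finite, the last condition always holds; for
an infinite `ψ` it makes the integrals of `g` under all policies meaningful. -/
def youngTestFunctions {X : Type*} (U : Type*) [TopologicalSpace X] [TopologicalSpace U]
    [MeasurableSpace X] (ψ : Measure X) : Set (X × U →ᵇ ℝ) :=
  {g | ∫⁻ x, ⨆ u, ‖g (x, u)‖ₑ ∂ψ < ∞}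

/-- The Young topology at input `ψ` on stationary policies: the coarsest topology for which
`γ ↦ ∫ ψ(dx) ∫ γ(du | x) g(x, u)` is continuous for every test function `g`. -/
@[reducible]
noncomputable def youngTopology {X : Type*} (U : Type*) [TopologicalSpace X] [TopologicalSpace U]
    [MeasurableSpace X] [MeasurableSpace U] (ψ : Measure X) :
    TopologicalSpace (StationaryPolicy X U) :=
  ⨅ g ∈ youngTestFunctions U ψ,
    TopologicalSpace.induced (fun γ => ∫ x, ∫ u, g (x, u) ∂(γ.1 x) ∂ψ) inferInstance

/-- The total variation norm `‖μ - ν‖` of the difference of two probability measures. -/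
noncomputable def tvDistance {X : Type*} [MeasurableSpace X] (μ ν : ProbabilityMeasure X) :
    ℝ≥0∞ :=
  ((μ : Measure X).toSignedMeasure - (ν : Measure X).toSignedMeasure).totalVariation univ

/-! An invariant measure is $\pi_\gamma = T\circ(\pi_\gamma\otimes\gamma)$, hence has as
$\psi$-density an average of the $f_{x,u}$. All these averages share one modulus of continuity at
each point. Along an ultrafilter converging to $\gamma$ they converge pointwise in $[0,\infty]$ to a
continuous $h$. Tightness, from either alternative of hypothesis 3, makes $h\psi$ a probability
measure and the convergence one in total variation (`exists_limit_density`).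

It remains to see that $h\psi$ is invariant under $\gamma$; uniqueness then gives
$h\psi=\pi_\gamma$. In the identity $\int F\,d\pi_{\gamma'}=\int\int TF\,d\gamma'\,d\pi_{\gamma'}$,
total variation convergence replaces $\pi_{\gamma'}$ by $h\psi$ although the integrand moves with
$\gamma'$. Young convergence at input $\psi$ then carries over to input $h\psi$ and to integrands
continuous in the action only (`continuous_integral_withDensity_policy`). -/

/-! ### One-sided comparison of probability measures -/

/-- `μ` exceeds `ν` by a measure of total mass at most `ε`. -/
def ExceedsByAtMost {X : Type*} [MeasurableSpace X] (μ ν : Measure X) (ε : ℝ≥0∞) : Prop :=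
  ∃ ρ : Measure X, ρ univ ≤ ε ∧ μ ≤ ν + ρ

theorem ExceedsByAtMost.measure_le {X : Type*} [MeasurableSpace X] {μ ν : Measure X} {ε : ℝ≥0∞}
    (h : ExceedsByAtMost μ ν ε) (s : Set X) : μ s ≤ ν s + ε := by
  obtain ⟨ρ, hρ, hle⟩ := h
  calc μ s ≤ (ν + ρ) s := hle s
    _ = ν s + ρ s := rfl
    _ ≤ ν s + ε := by gcongr; exact (measure_mono (subset_univ _)).trans hρ

/-- The one-sided bound can be integrated against the nonnegative function $g+C\le 2C$, and $C$
cancels because both masses are one; $-g$ gives the other sign. -/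
theorem ExceedsByAtMost.abs_integral_sub_le {X : Type*} [MeasurableSpace X] {μ ν : Measure X}
    [IsProbabilityMeasure μ] [IsProbabilityMeasure ν] {ε : ℝ≥0∞} (hε : ε ≠ ∞)
    (h : ExceedsByAtMost μ ν ε) {g : X → ℝ} (hg : Measurable g) {C : ℝ} (hC : ∀ x, |g x| ≤ C) :
    |∫ x, g x ∂μ - ∫ x, g x ∂ν| ≤ 2 * C * ε.toReal := by
  obtain ⟨ρ, hρ, hle⟩ := h
  have : IsFiniteMeasure ρ := ⟨hρ.trans_lt hε.lt_top⟩
  have C0 : 0 ≤ C := by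
    obtain ⟨x⟩ : Nonempty X := nonempty_of_isProbabilityMeasure μ
    exact (abs_nonneg _).trans (hC x)
  have key : ∀ g : X → ℝ, Measurable g → (∀ x, |g x| ≤ C) →
      ∫ x, g x ∂μ - ∫ x, g x ∂ν ≤ 2 * C * ε.toReal := by
    intro g hg hC
    have hint : ∀ (m : Measure X) [IsFiniteMeasure m], Integrable g m := fun m _ =>
      Integrable.of_bound hg.aestronglyMeasurable C (ae_of_all _ hC)
    have h1 : ∫ x, (g x + C) ∂μ ≤ ∫ x, (g x + C) ∂(ν + ρ) := by
      apply integral_mono_measure hle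
      · exact ae_of_all _ fun x => by have := (abs_le.1 (hC x)).1; simp only [Pi.zero_apply]; linarith
      · exact (hint _).add (integrable_const _)
    have hintC : ∀ (m : Measure X) [IsFiniteMeasure m], Integrable (fun x => g x + C) m :=
      fun m _ => (hint m).add (integrable_const _)
    rw [integral_add_measure (hintC _) (hintC _), integral_add (hint _) (integrable_const _),
      integral_add (hint _) (integrable_const _)] at h1
    have h2 : ∫ x, (g x + C) ∂ρ ≤ ∫ _, 2 * C ∂ρ :=
      integral_mono ((hint _).add (integrable_const _)) (integrable_const _)
        fun x => by have := (abs_le.1 (hC x)).2; simp only; linarith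
    have h3 : ρ.real univ ≤ ε.toReal := ENNReal.toReal_mono hε hρ
    simp only [integral_const, probReal_univ, smul_eq_mul] at h1 h2
    have : ρ.real univ * (2 * C) ≤ ε.toReal * (2 * C) := by gcongr
    linarith
  refine abs_le.2 ⟨?_, key g hg hC⟩
  have := key (fun x => - g x) hg.neg (fun x => by rw [abs_neg]; exact hC x)
  rw [integral_neg, integral_neg] at this
  linarith

/-- Since both masses are one, the deficit on a set equals the excess on its complement, so each
Jordan part has mass at most $\varepsilon$. -/
theorem ExceedsByAtMost.tvDistance_le {X : Type*} [MeasurableSpace X]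
    {μ ν : ProbabilityMeasure X} {ε : ℝ≥0∞} (hε : ε ≠ ∞)
    (h : ExceedsByAtMost (μ : Measure X) (ν : Measure X) ε) :
    tvDistance μ ν ≤ 2 * ε := by
  have key : ∀ s, MeasurableSet s →
      (μ : Measure X).real s - (ν : Measure X).real s ≤ ε.toReal := by
    intro s _
    have := ENNReal.toReal_mono (by finiteness) (h.measure_le s)
    rw [ENNReal.toReal_add (by finiteness) hε] at this
    simp only [measureReal_def]
    linarith
  rw [tvDistance]
  set s := (μ : Measure X).toSignedMeasure - (ν : Measure X).toSignedMeasure with hs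
  have hsi : ∀ i, MeasurableSet i →
      s i = (μ : Measure X).real i - (ν : Measure X).real i := fun i hi => by
    rw [hs, sub_apply, Measure.toSignedMeasure_apply_measurable hi,
      Measure.toSignedMeasure_apply_measurable hi]
  obtain ⟨i, hi₁, hi₂, hi₃, hp, hn⟩ := s.toJordanDecomposition_spec
  rw [SignedMeasure.totalVariation, Measure.add_apply, hp, hn,
    SignedMeasure.toMeasureOfZeroLE_apply _ _ _ .univ,
    SignedMeasure.toMeasureOfLEZero_apply _ _ _ .univ, two_mul]
  have aux : ∀ a : ℝ≥0, (a : ℝ) ≤ ε.toReal → (a : ℝ≥0∞) ≤ ε := fun a ha => by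
    rw [← ENNReal.ofReal_toReal hε, ← ENNReal.ofReal_coe_nnreal]
    exact ENNReal.ofReal_le_ofReal ha
  refine add_le_add (aux _ ?_) (aux _ ?_)
  · change s (i ∩ univ) ≤ _
    rw [inter_univ, hsi i hi₁]
    exact key i hi₁
  · change -s (iᶜ ∩ univ) ≤ _
    rw [inter_univ, hsi _ hi₁.compl, probReal_compl_eq_one_sub hi₁, probReal_compl_eq_one_sub hi₁]
    have := key i hi₁
    linarith

/-! ### Averages of equicontinuous densities -/

section Densities

variable {P X : Type*} [MeasurableSpace P] [MetricSpace X] [MeasurableSpace X] [BorelSpace X] {ψ : Measure X} {f : P → X → ℝ≥0}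

theorem Equicontinuous.eventually_le_add_ennreal {P X : Type*} [TopologicalSpace X]
    {f : P → X → ℝ≥0} (hf : Equicontinuous f) (y : X) {ε : ℝ≥0∞}
    (hε : ε ≠ 0) :
    ∀ᶠ z in 𝓝 y, ∀ p, (f p y : ℝ≥0∞) ≤ f p z + ε ∧ (f p z : ℝ≥0∞) ≤ f p y + ε := by
  obtain ⟨δ, hδ0, hδ⟩ := ENNReal.lt_iff_exists_nnreal_btwn.1 (pos_iff_ne_zero.2 hε)
  have hδ0' : 0 < (δ : ℝ) := by exact_mod_cast hδ0
  filter_upwards [Metric.equicontinuousAt_iff_right.1 (hf y) δ hδ0'] with z hz p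
  have h := abs_lt.1 (NNReal.dist_eq _ _ ▸ hz p)
  have h1 : f p y ≤ f p z + δ := by
    rw [← NNReal.coe_le_coe, NNReal.coe_add]; linarith
  have h2 : f p z ≤ f p y + δ := by
    rw [← NNReal.coe_le_coe, NNReal.coe_add]; linarith
  constructor
  · calc (f p y : ℝ≥0∞) ≤ f p z + δ := by exact_mod_cast h1
      _ ≤ _ := by gcongr
  · calc (f p z : ℝ≥0∞) ≤ f p y + δ := by exact_mod_cast h2
      _ ≤ _ := by gcongr

/-- An equicontinuous family of densities of a kernel depends measurably on the parameter at the
points of the support of the reference measure. -/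
theorem measurable_density_of_mem_support (κ : Kernel P X) [IsMarkovKernel κ]
    (hκ : ∀ p, κ p = ψ.withDensity fun y => (f p y : ℝ≥0∞)) (hf : Equicontinuous f)
    {y : X} (hy : y ∈ ψ.support) : Measurable fun p => f p y := by
  have hball : ∀ k : ℕ, 0 < ψ (Metric.ball y (1 / ((k : ℝ) + 1))) := fun k =>
    (Measure.mem_support_iff_forall y).1 hy _ (Metric.ball_mem_nhds _ Nat.one_div_pos_of_nat)
  rw [← measurable_coe_nnreal_ennreal_iff]
  -- The density at `y` is the limit of its averages over shrinking balls, which have positive mass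
  -- because `y` is in the support. A ball of infinite mass does no harm, since `κ p` is finite.
  refine measurable_of_tendsto_metrizable
    (f := fun (k : ℕ) p => κ p (Metric.ball y (1 / ((k : ℝ) + 1))) /
      ψ (Metric.ball y (1 / ((k : ℝ) + 1))))
    (fun k => (κ.measurable_coe Metric.isOpen_ball.measurableSet).div_const _)
    (tendsto_pi_nhds.2 fun p => ?_)
  rw [ENNReal.tendsto_nhds ENNReal.coe_ne_top]
  intro ε hε
  obtain ⟨r, hr, hball'⟩ := Metric.eventually_nhds_iff_ball.1
    (hf.eventually_le_add_ennreal y hε.ne')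
  filter_upwards [(tendsto_one_div_add_atTop_nhds_zero_nat (𝕜 := ℝ)).eventually_lt_const hr]
    with k hk
  set B := Metric.ball y (1 / ((k : ℝ) + 1)) with hB
  have hBm : MeasurableSet B := Metric.isOpen_ball.measurableSet
  have hfB : ∀ z ∈ B, (f p y : ℝ≥0∞) ≤ f p z + ε ∧ (f p z : ℝ≥0∞) ≤ f p y + ε := fun z hz =>
    hball' z (Metric.ball_subset_ball hk.le hz) p
  have hκB : κ p B = ∫⁻ z in B, f p z ∂ψ := by rw [hκ, withDensity_apply _ hBm]
  constructor
  · rw [ENNReal.le_div_iff_mul_le (Or.inl (hball k).ne') (Or.inr (by finiteness)), hκB,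
      ← setLIntegral_const]
    exact setLIntegral_mono' hBm fun z hz => tsub_le_iff_right.2 (hfB z hz).1
  · apply ENNReal.div_le_of_le_mul
    rw [hκB, ← setLIntegral_const]
    exact setLIntegral_mono' hBm fun z hz => (hfB z hz).2

/-- On the support the density is a Carathéodory function; the complement of the support is
$\psi$-null, so the density may be replaced by zero there. -/
theorem aemeasurable_uncurry_density [SecondCountableTopology X] (κ : Kernel P X) [IsMarkovKernel κ]
    (hκ : ∀ p, κ p = ψ.withDensity fun y => (f p y : ℝ≥0∞)) (hf : Equicontinuous f)
    (μ : Measure P) [SFinite μ] [SFinite ψ] :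
    AEMeasurable (Function.uncurry fun p y => (f p y : ℝ≥0∞)) (μ.prod ψ) := by
  have hS : MeasurableSet ψ.support := Measure.isClosed_support.measurableSet
  have hu : Measurable (Function.uncurry fun (y : ψ.support) p => f p y) :=
    measurable_uncurry_of_continuous_of_measurable
      (fun p => (hf.continuous p).comp continuous_subtype_val)
      fun y => measurable_density_of_mem_support κ hκ hf y.2
  let s : Set (P × X) := {q | q.2 ∈ ψ.support}
  have hs : MeasurableSet s := measurable_snd hS
  refine ⟨s.indicator (Function.uncurry fun p y => (f p y : ℝ≥0∞)), ?_, ?_⟩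
  · refine measurable_of_restrict_of_restrict_compl hs ?_ ?_
    · have : Measurable fun q : s => ((⟨q.1.2, q.2⟩ : ψ.support), q.1.1) :=
        Measurable.prodMk (measurable_snd.comp measurable_subtype_coe).subtype_mk
          (measurable_fst.comp measurable_subtype_coe)
      convert (hu.comp this).coe_nnreal_ennreal using 1
      ext q
      simp only [Set.domRestrict_apply, indicator_of_mem q.2]
      rfl
    · convert measurable_const (a := (0 : ℝ≥0∞)) using 1
      ext q
      have := q.2
      simp only [mem_compl_iff] at this
      simp [this, indicator_of_notMem]
  · have : ∀ᵐ q ∂μ.prod ψ, q.2 ∈ ψ.support :=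
      Measure.quasiMeasurePreserving_snd.ae Measure.support_mem_ae
    filter_upwards [this] with q hq
    rw [indicator_of_mem]
    exact hq

theorem comp_eq_withDensity [SecondCountableTopology X] (κ : Kernel P X) [IsMarkovKernel κ]
    (hκ : ∀ p, κ p = ψ.withDensity fun y => (f p y : ℝ≥0∞)) (hf : Equicontinuous f)
    (μ : Measure P) [SFinite μ] [SFinite ψ] :
    κ ∘ₘ μ = ψ.withDensity fun y => ∫⁻ p, f p y ∂μ := by
  ext B hB
  rw [Measure.bind_apply hB κ.aemeasurable, withDensity_apply _ hB, ← lintegral_lintegral_swap]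
  · exact lintegral_congr fun p => by rw [hκ, withDensity_apply _ hB]
  · exact (aemeasurable_uncurry_density κ hκ hf μ).mono_ac
      (Measure.AbsolutelyContinuous.rfl.prod Measure.restrict_le_self.absolutelyContinuous)

end Densities

/-! ### Total variation limits along an ultrafilter -/

theorem IsCompact.eventually_forall_of_eventually_prod {X ι : Type*} [TopologicalSpace X]
    {K : Set X} (hK : IsCompact K) {l : Filter ι} {Q : X → ι → Prop}
    (h : ∀ x ∈ K, ∀ᶠ q in 𝓝 x ×ˢ l, Q q.1 q.2) : ∀ᶠ i in l, ∀ x ∈ K, Q x i := by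
  obtain ⟨t, ht, s, hs, hts⟩ := mem_prod_iff.1 (hK.mem_nhdsSet_prod_of_forall h)
  filter_upwards [hs] with i hi x hx
  exact hts (mk_mem_prod (subset_of_mem_nhdsSet ht hx) hi)

section LimitDensity

variable {P X : Type*} [MeasurableSpace P] [MetricSpace X] [MeasurableSpace X] [BorelSpace X]
  {ψ : Measure X} {f : P → X → ℝ≥0}

/-- The set of points charged by some member of a family of densities. -/
def positivitySet {P X : Type*} (f : P → X → ℝ≥0) : Set X := {y | ∃ p, f p y ≠ 0}

theorem isOpen_positivitySet {P X : Type*} [TopologicalSpace X] {f : P → X → ℝ≥0}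
    (hf : Equicontinuous f) : IsOpen (positivitySet f) := by
  have : positivitySet f = ⋃ p, {y | f p y ≠ 0} := by ext; simp [positivitySet]
  rw [this]
  exact isOpen_iUnion fun p => isOpen_ne_fun (hf.continuous p) continuous_const

/-- Near `y` some density stays above half its value at `y`, and its integral is at most one. This
stands in for local finiteness, which $\sigma$-finiteness does not give. -/
theorem finiteAtFilter_of_mem_positivitySet (κ : Kernel P X) [IsMarkovKernel κ]
    (hκ : ∀ p, κ p = ψ.withDensity fun y => (f p y : ℝ≥0∞)) (hf : Equicontinuous f)
    {y : X} (hy : y ∈ positivitySet f) : ψ.FiniteAtFilter (𝓝 y) := by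
  obtain ⟨p, hp⟩ := hy
  have hε : (f p y : ℝ≥0∞) / 2 ≠ 0 := by simpa using hp
  obtain ⟨V, hV, hVo, hyV⟩ := eventually_nhds_iff.1 (hf.eventually_le_add_ennreal y hε)
  refine ⟨V, hVo.mem_nhds hyV, ?_⟩
  have h1 : (f p y : ℝ≥0∞) / 2 * ψ V ≤ 1 := by
    calc (f p y : ℝ≥0∞) / 2 * ψ V = ∫⁻ _ in V, (f p y : ℝ≥0∞) / 2 ∂ψ := by rw [setLIntegral_const]
      _ ≤ ∫⁻ z in V, f p z ∂ψ := by
        refine setLIntegral_mono' hVo.measurableSet fun z hz => ?_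
        have := (hV z hz p).1
        rwa [← tsub_le_iff_right, ENNReal.sub_half ENNReal.coe_ne_top] at this
      _ = κ p V := by rw [hκ, withDensity_apply _ hVo.measurableSet]
      _ ≤ 1 := prob_le_one
  by_contra hcon
  rw [not_lt_top_iff.1 hcon, ENNReal.mul_top hε] at h1
  simp at h1

theorem measure_lt_top_of_subset_positivitySet (κ : Kernel P X) [IsMarkovKernel κ]
    (hκ : ∀ p, κ p = ψ.withDensity fun y => (f p y : ℝ≥0∞)) (hf : Equicontinuous f)
    {K : Set X} (hK : IsCompact K) (hKf : K ⊆ positivitySet f) : ψ K < ∞ :=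
  hK.measure_lt_top_of_nhdsWithin fun _ hx =>
    (finiteAtFilter_of_mem_positivitySet κ hκ hf (hKf hx)).filter_mono nhdsWithin_le_nhds

/-- The laws `κ ∘ₘ μ i` of a Markov kernel with equicontinuous densities, if they are tight in the
set that the kernel charges, converge in total variation along every ultrafilter, and the limit
has a continuous density. -/
theorem exists_limit_density [SecondCountableTopology X] [ProperSpace X] [SFinite ψ]
    {ι : Type*} (𝒰 : Ultrafilter ι)
    (κ : Kernel P X) [IsMarkovKernel κ]
    (hκ : ∀ p, κ p = ψ.withDensity fun y => (f p y : ℝ≥0∞)) (hf : Equicontinuous f)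
    (μ : ι → Measure P) [∀ i, IsProbabilityMeasure (μ i)]
    (tight : ∀ ε : ℝ≥0∞, ε ≠ 0 → ∃ K, IsCompact K ∧ K ⊆ ψ.support ∩ positivitySet f ∧
      ∀ᶠ i in (𝒰 : Filter ι), (κ ∘ₘ μ i) Kᶜ ≤ ε) :
    ∃ h : X → ℝ≥0∞, Continuous h ∧ ψ.withDensity h univ = 1 ∧ ∀ ε : ℝ≥0∞, ε ≠ 0 →
      ∀ᶠ i in (𝒰 : Filter ι), ExceedsByAtMost (κ ∘ₘ μ i) (ψ.withDensity h) ε := by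
  set H : ι → X → ℝ≥0∞ := fun i y => ∫⁻ p, f p y ∂μ i with hH
  have hHμ : ∀ i, κ ∘ₘ μ i = ψ.withDensity (H i) := fun i => comp_eq_withDensity κ hκ hf (μ i)
  -- Compactness of $[0,\infty]$ gives the limits; the value $\infty$ is possible at this stage.
  have : ∀ y, ∃ a, Tendsto (H · y) 𝒰 (𝓝 a) := fun y =>
    ⟨_, (𝒰.map (H · y)).le_nhds_lim⟩
  choose h ht using this
  have hHosc : ∀ y, ∀ ε : ℝ≥0∞, ε ≠ 0 → ∀ᶠ z in 𝓝 y, ∀ i, H i y ≤ H i z + ε ∧ H i z ≤ H i y + ε := by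
    intro y ε hε
    filter_upwards [hf.eventually_le_add_ennreal y hε] with z hz i
    have aux : ∀ a b : X, (∀ p, (f p a : ℝ≥0∞) ≤ f p b + ε) → H i a ≤ H i b + ε := by
      intro a b hab
      calc H i a ≤ ∫⁻ p, (f p b + ε) ∂μ i := lintegral_mono hab
        _ = H i b + ε := by rw [lintegral_add_right _ measurable_const]; simp [hH]
    exact ⟨aux _ _ fun p => (hz p).1, aux _ _ fun p => (hz p).2⟩
  have hosc : ∀ y, ∀ ε : ℝ≥0∞, ε ≠ 0 → ∀ᶠ z in 𝓝 y, h y ≤ h z + ε ∧ h z ≤ h y + ε := by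
    intro y ε hε
    filter_upwards [hHosc y ε hε] with z hz
    exact ⟨le_of_tendsto_of_tendsto' (ht y) ((ht z).add_const ε) fun i => (hz i).1,
      le_of_tendsto_of_tendsto' (ht z) ((ht y).add_const ε) fun i => (hz i).2⟩
  have hcont : Continuous h := by
    refine continuous_iff_continuousAt.2 fun y => ?_
    by_cases hy : h y = ∞
    · refine Tendsto.congr' (f₁ := fun _ => ∞) ?_ (by rw [hy]; exact tendsto_const_nhds)
      filter_upwards [hosc y 1 one_ne_zero] with z hz
      have := hz.1
      rw [hy, top_le_iff, ENNReal.add_eq_top] at this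
      simpa [eq_comm] using this
    · refine (ENNReal.tendsto_nhds hy).2 fun ε hε => ?_
      filter_upwards [hosc y ε hε.ne'] with z hz
      exact ⟨tsub_le_iff_right.2 hz.1, hz.2⟩
  have hmeas : Measurable h := hcont.measurable
  have hle1 : ∀ i (s : Set X), (κ ∘ₘ μ i) s ≤ 1 := fun i s => prob_le_one
  have hfin : ∀ y ∈ ψ.support ∩ positivitySet f, h y ≠ ∞ := by
    rintro y ⟨hyS, hyf⟩
    obtain ⟨W, hW, hWfin⟩ := finiteAtFilter_of_mem_positivitySet κ hκ hf hyf
    obtain ⟨V, hV, hVo, hyV⟩ := eventually_nhds_iff.1 ((hHosc y 1 one_ne_zero).and hW)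
    have hVpos : ψ V ≠ 0 :=
      ((Measure.mem_support_iff_forall y).1 hyS V (hVo.mem_nhds hyV)).ne'
    have hVfin : ψ V ≠ ∞ := ((measure_mono fun z hz => (hV z hz).2).trans_lt hWfin).ne
    -- On `V` the density is at least `H i y - 1`, while its integral over `V` is at most one.
    have hbd : ∀ i, H i y ≤ (1 + ψ V) / ψ V := by
      intro i
      rw [ENNReal.le_div_iff_mul_le (Or.inl hVpos) (Or.inl hVfin)]
      calc H i y * ψ V = ∫⁻ _ in V, H i y ∂ψ := by rw [setLIntegral_const]
        _ ≤ ∫⁻ z in V, (H i z + 1) ∂ψ :=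
          setLIntegral_mono' hVo.measurableSet fun z hz => ((hV z hz).1 i).1
        _ = (κ ∘ₘ μ i) V + ψ V := by
          rw [lintegral_add_right _ measurable_const, hHμ, withDensity_apply _ hVo.measurableSet]
          simp
        _ ≤ 1 + ψ V := by gcongr; exact hle1 i V
    exact ((le_of_tendsto' (ht y) hbd).trans_lt
      (ENNReal.div_lt_top (by finiteness) hVpos)).ne
  -- The upper bound is trivial where $h=\infty$, so any compact set will do; the lower bound below
  -- needs $h$ finite and hence a compact subset of the charged set.
  have upper : ∀ K, IsCompact K → ∀ ε : ℝ≥0∞, ε ≠ 0 →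
      ∀ᶠ i in (𝒰 : Filter ι), ∀ y ∈ K, H i y ≤ h y + ε := by
    intro K hK ε hε
    refine hK.eventually_forall_of_eventually_prod (Q := fun y i => H i y ≤ h y + ε) fun x _ => ?_
    have hε3 : ε / 3 ≠ 0 := (ENNReal.div_pos hε (by simp)).ne'
    have hx : ∀ᶠ i in (𝒰 : Filter ι), H i x ≤ h x + ε / 3 := by
      by_cases hx : h x = ∞
      · simp [hx]
      · exact (ht x).eventually_le_const (ENNReal.lt_add_right hx hε3)
    filter_upwards [((hHosc x _ hε3).and (hosc x _ hε3)).prod_mk hx] with q hq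
    obtain ⟨⟨h1, h2⟩, h3⟩ := hq
    calc H q.2 q.1 ≤ H q.2 x + ε / 3 := (h1 q.2).2
      _ ≤ h x + ε / 3 + ε / 3 := by gcongr
      _ ≤ h q.1 + ε / 3 + ε / 3 + ε / 3 := by gcongr; exact h2.1
      _ = h q.1 + (ε / 3 + ε / 3 + ε / 3) := by ring
      _ = h q.1 + ε := by rw [ENNReal.add_thirds]
  have lower : ∀ K, IsCompact K → K ⊆ ψ.support ∩ positivitySet f → ∀ ε : ℝ≥0∞, ε ≠ 0 →
      ∀ᶠ i in (𝒰 : Filter ι), ∀ y ∈ K, h y ≤ H i y + ε := by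
    intro K hK hKs ε hε
    refine hK.eventually_forall_of_eventually_prod (Q := fun y i => h y ≤ H i y + ε)
      fun x hxK => ?_
    have hε3 : ε / 3 ≠ 0 := (ENNReal.div_pos hε (by simp)).ne'
    have hx : ∀ᶠ i in (𝒰 : Filter ι), h x ≤ H i x + ε / 3 := by
      filter_upwards [((ENNReal.tendsto_nhds (hfin x (hKs hxK))).1 (ht x) (ε / 3)
        (pos_iff_ne_zero.2 hε3))] with i hi
      exact tsub_le_iff_right.1 hi.1
    filter_upwards [((hHosc x _ hε3).and (hosc x _ hε3)).prod_mk hx] with q hq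
    obtain ⟨⟨h1, h2⟩, h3⟩ := hq
    calc h q.1 ≤ h x + ε / 3 := h2.2
      _ ≤ H q.2 x + ε / 3 + ε / 3 := by gcongr
      _ ≤ H q.2 q.1 + ε / 3 + ε / 3 + ε / 3 := by gcongr; exact (h1 q.2).1
      _ = H q.2 q.1 + (ε / 3 + ε / 3 + ε / 3) := by ring
      _ = H q.2 q.1 + ε := by rw [ENNReal.add_thirds]
  have hKfin : ∀ K, IsCompact K → K ⊆ ψ.support ∩ positivitySet f → ψ K ≠ ∞ := fun K hK hKs =>
    (measure_lt_top_of_subset_positivitySet κ hκ hf hK (hKs.trans inter_subset_right)).ne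
  have exceeds : ∀ ε : ℝ≥0∞, ε ≠ 0 →
      ∀ᶠ i in (𝒰 : Filter ι), ExceedsByAtMost (κ ∘ₘ μ i) (ψ.withDensity h) ε := by
    intro ε hε
    have hε2 : ε / 2 ≠ 0 := (ENNReal.div_pos hε (by simp)).ne'
    obtain ⟨K, hK, hKs, hKt⟩ := tight (ε / 2) hε2
    obtain ⟨δ, hδ0, hδ⟩ := ENNReal.exists_nnreal_pos_mul_lt (hKfin K hK hKs) hε2
    filter_upwards [hKt, upper K hK δ (by exact_mod_cast hδ0.ne')] with i hi hu
    -- The excess is the uniform error $\delta$ on `K` together with all the mass off `K`.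
    refine ⟨(δ : ℝ≥0∞) • ψ.restrict K + (κ ∘ₘ μ i).restrict Kᶜ, ?_, ?_⟩
    · simp only [Measure.add_apply, Measure.smul_apply, Measure.restrict_apply_univ, smul_eq_mul]
      calc _ ≤ ε / 2 + ε / 2 := add_le_add hδ.le hi
        _ = ε := ENNReal.add_halves ε
    · refine Measure.le_iff.2 fun B hB => ?_
      have hBK : (κ ∘ₘ μ i) (B ∩ K) ≤ ψ.withDensity h B + δ * ψ (B ∩ K) := by
        have hm := hB.inter hK.measurableSet
        calc (κ ∘ₘ μ i) (B ∩ K) = ∫⁻ y in B ∩ K, H i y ∂ψ := by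
              rw [hHμ, withDensity_apply _ hm]
          _ ≤ ∫⁻ y in B ∩ K, (h y + δ) ∂ψ := setLIntegral_mono' hm fun y hy => hu y hy.2
          _ = ψ.withDensity h (B ∩ K) + δ * ψ (B ∩ K) := by
            rw [lintegral_add_right _ measurable_const, withDensity_apply _ hm]
            simp
          _ ≤ _ := by gcongr; exact inter_subset_left
      calc (κ ∘ₘ μ i) B ≤ (κ ∘ₘ μ i) (B ∩ K) + (κ ∘ₘ μ i) (B ∩ Kᶜ) := by
            rw [← sdiff_eq]; exact measure_le_inter_add_sdiff _ _ _
        _ ≤ ψ.withDensity h B + δ * ψ (B ∩ K) + (κ ∘ₘ μ i) (B ∩ Kᶜ) := by gcongr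
        _ = _ := by
          simp only [Measure.add_apply, Measure.smul_apply, Measure.restrict_apply hB, smul_eq_mul]
          rw [add_assoc]
  refine ⟨h, hcont, le_antisymm ?_ ?_, exceeds⟩
  · have hK1 : ∀ K, IsCompact K → K ⊆ ψ.support ∩ positivitySet f → ψ.withDensity h K ≤ 1 := by
      intro K hK hKs
      refine ENNReal.le_of_forall_pos_le_add fun ε hε _ => ?_
      obtain ⟨δ, hδ0, hδ⟩ := ENNReal.exists_nnreal_pos_mul_lt (hKfin K hK hKs)
        (ENNReal.coe_ne_zero.2 hε.ne')
      obtain ⟨i, hi⟩ := (lower K hK hKs δ (by exact_mod_cast hδ0.ne')).exists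
      calc ψ.withDensity h K = ∫⁻ y in K, h y ∂ψ := withDensity_apply _ hK.measurableSet
        _ ≤ ∫⁻ y in K, (H i y + δ) ∂ψ := setLIntegral_mono' hK.measurableSet hi
        _ = (κ ∘ₘ μ i) K + δ * ψ K := by
          rw [lintegral_add_right _ measurable_const, hHμ, withDensity_apply _ hK.measurableSet]
          simp
        _ ≤ 1 + ε := add_le_add (hle1 i K) hδ.le
    -- Compact sets exhaust the charged part of the support. Elsewhere $h\psi$ vanishes: the
    -- complement of the support is null, and $h=0$ where all densities are.
    obtain ⟨F, hFc, hFs, hFU, hFm⟩ := (isOpen_positivitySet hf).exists_iUnion_isClosed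
    let K : ℕ → Set X := fun n => compactCovering X n ∩ (ψ.support ∩ F n)
    have hKm : Monotone K := fun m n hmn =>
      inter_subset_inter (compactCovering_subset X hmn) (inter_subset_inter_right _ (hFm hmn))
    have hcov : (univ : Set X) ⊆ (⋃ n, K n) ∪ (ψ.supportᶜ ∪ (positivitySet f)ᶜ) := by
      intro x _
      by_cases hxS : x ∈ ψ.support
      · by_cases hxf : x ∈ positivitySet f
        · left
          obtain ⟨m, hm⟩ := mem_iUnion.1 (hFU.symm ▸ hxf : x ∈ ⋃ n, F n)
          obtain ⟨k, hk⟩ := exists_mem_compactCovering x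
          exact mem_iUnion.2 ⟨max m k, compactCovering_subset X (le_max_right _ _) hk, hxS,
            hFm (le_max_left _ _) hm⟩
        · exact Or.inr (Or.inr hxf)
      · exact Or.inr (Or.inl hxS)
    have h1 : ψ.withDensity h (⋃ n, K n) ≤ 1 := by
      rw [hKm.measure_iUnion]
      exact iSup_le fun n => hK1 _
        ((isCompact_compactCovering X n).inter_right (Measure.isClosed_support.inter (hFc n)))
        (inter_subset_right.trans (inter_subset_inter_right _ (hFs n)))
    have h2 : ψ.withDensity h ψ.supportᶜ = 0 :=
      withDensity_absolutelyContinuous ψ h Measure.measure_compl_support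
    have h3 : ψ.withDensity h (positivitySet f)ᶜ = 0 := by
      rw [withDensity_apply _ (isOpen_positivitySet hf).measurableSet.compl,
        setLIntegral_eq_zero (isOpen_positivitySet hf).measurableSet.compl]
      intro y hy
      have hy0 : ∀ p, f p y = 0 := fun p => by
        by_contra hp
        exact hy ⟨p, hp⟩
      have : ∀ i, H i y = 0 := fun i => by simp [hH, hy0]
      exact tendsto_nhds_unique (ht y) (by simp [this])
    calc ψ.withDensity h univ
        ≤ ψ.withDensity h (⋃ n, K n) + (ψ.withDensity h ψ.supportᶜ +
          ψ.withDensity h (positivitySet f)ᶜ) := (measure_mono hcov).trans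
          ((measure_union_le _ _).trans (by gcongr; exact measure_union_le _ _))
      _ ≤ 1 := by rw [h2, h3]; simpa using h1
  · refine ENNReal.le_of_forall_pos_le_add fun ε hε _ => ?_
    obtain ⟨i, hi⟩ := (exceeds ε (by exact_mod_cast hε.ne')).exists
    simpa using hi.measure_le univ

end LimitDensity

/-! ### Young convergence under a change of input -/

/-- A map into the continuous functions on a compact metric space is strongly measurable if its
evaluations are measurable. -/
theorem ContinuousMap.stronglyMeasurable_of_eval {X U : Type*} [MeasurableSpace X]
    [MetricSpace U] [CompactSpace U] {Γ : X → C(U, ℝ)} (h : ∀ u, Measurable fun x => Γ x u) :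
    StronglyMeasurable Γ := by
  borelize C(U, ℝ)
  refine Measurable.stronglyMeasurable ?_
  have hb : TopologicalSpace.IsTopologicalBasis
      {s : Set C(U, ℝ) | ∃ c r, s = Metric.ball c r} := by
    refine TopologicalSpace.isTopologicalBasis_of_isOpen_of_nhds ?_ ?_
    · rintro _ ⟨c, r, rfl⟩
      exact Metric.isOpen_ball
    · intro a s ha hs
      obtain ⟨r, hr, hrs⟩ := Metric.isOpen_iff.1 hs a ha
      exact ⟨_, ⟨a, r, rfl⟩, Metric.mem_ball_self hr, hrs⟩
  -- By continuity the distance is controlled on a countable dense set. Balls suffice because they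
  -- form a basis of a second countable space.
  have key : ∀ c : C(U, ℝ), Measurable fun x => dist (Γ x) c := by
    intro c
    refine measurable_of_Iic fun r => ?_
    rcases lt_or_ge r 0 with hr | hr
    · convert MeasurableSet.empty
      ext x
      simpa using hr.trans_le dist_nonneg
    obtain ⟨D, hDc, hD⟩ := TopologicalSpace.exists_countable_dense U
    have : (fun x => dist (Γ x) c) ⁻¹' Iic r = ⋂ u ∈ D, {x | dist (Γ x u) (c u) ≤ r} := by
      ext x
      simp only [mem_preimage, mem_Iic, mem_iInter, mem_ofPred_eq]
      rw [ContinuousMap.dist_le hr]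
      refine ⟨fun hx u _ => hx u, fun hx u => ?_⟩
      have hcl : IsClosed {u | dist (Γ x u) (c u) ≤ r} :=
        isClosed_le ((Γ x).continuous.dist c.continuous) continuous_const
      exact hcl.closure_subset_iff.2 hx (hD u)
    rw [this]
    exact MeasurableSet.biInter hDc fun u _ =>
      measurableSet_le ((h u).dist measurable_const) measurable_const
  rw [BorelSpace.measurable_eq (α := C(U, ℝ)), hb.borel_eq_generateFrom]
  refine measurable_generateFrom ?_
  rintro _ ⟨c, r, rfl⟩
  exact measurableSet_lt (key c) measurable_const

section Young

variable {X U : Type*} [MetricSpace X] [SecondCountableTopology X] [MeasurableSpace X]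
  [BorelSpace X] [MetricSpace U] [CompactSpace U] [MeasurableSpace U] [BorelSpace U]
  {ψ : Measure X}

theorem continuous_integral_youngTestFunction {X U : Type*} [TopologicalSpace X]
    [TopologicalSpace U] [MeasurableSpace X] [MeasurableSpace U] {ψ : Measure X} {g : X × U →ᵇ ℝ}
    (hg : g ∈ youngTestFunctions U ψ) :
    Continuous[youngTopology U ψ, inferInstance]
      fun γ : StationaryPolicy X U => ∫ x, ∫ u, g (x, u) ∂(γ.1 x) ∂ψ := by
  let _ := youngTopology (X := X) U ψ
  exact continuous_iInf_dom (i := g) (continuous_iInf_dom (i := hg) continuous_induced_dom)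

theorem stronglyMeasurable_integral_policy {X U : Type*} [MeasurableSpace X] [MeasurableSpace U]
    (γ : StationaryPolicy X U) {G : X × U → ℝ} (hG : Measurable G) :
    StronglyMeasurable fun x => ∫ u, G (x, u) ∂(γ.1 x) :=
  have := γ.2
  hG.stronglyMeasurable.integral_kernel_prod_right'

/-- In the Young topology at input `ψ`, the integral of a bounded Carathéodory function against the
policy is continuous also if the input is replaced by a probability measure with a continuous
density. -/
theorem continuous_integral_withDensity_policy {h : X → ℝ≥0∞} (hh : Continuous h)
    (hh1 : ψ.withDensity h univ = 1) {G : X × U → ℝ} (hG : Measurable G)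
    (hGc : ∀ x, Continuous fun u => G (x, u)) {C : ℝ} (hC : ∀ q, |G q| ≤ C) :
    Continuous[youngTopology U ψ, inferInstance] fun γ : StationaryPolicy X U =>
      ∫ x, ∫ u, G (x, u) ∂(γ.1 x) ∂(ψ.withDensity h) := by
  let _ := youngTopology (X := X) U ψ
  -- The splitting $h=wk$ leaves a finite measure $m=w\psi$ with bounded continuous weight, and puts
  -- the unbounded factor $k$ into the integrand, where only $m$-integrability is needed.
  set w : X → ℝ≥0∞ := fun x => min (h x) 1 with hw
  set k : X → ℝ≥0∞ := fun x => max (h x) 1 with hk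
  have hwc : Continuous w := hh.min continuous_const
  have hkc : Continuous k := hh.max continuous_const
  have hw1 : ∀ x, w x ≤ 1 := fun x => min_le_right _ _
  have hwk : h = w * k := by
    ext x
    simp only [hw, hk, Pi.mul_apply, min_mul_max, mul_one]
  set m := ψ.withDensity w with hm
  have hhm : ψ.withDensity h = m.withDensity k := by
    rw [hm, ← withDensity_mul _ hwc.measurable hkc.measurable, ← hwk]
  have hint : ∫⁻ x, h x ∂ψ = 1 := by simpa [withDensity_apply] using hh1
  have hwint : ∫⁻ x, w x ∂ψ ≤ 1 := hint ▸ lintegral_mono fun x => min_le_left _ _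
  have : IsFiniteMeasure m := ⟨by
    rw [hm, withDensity_apply _ .univ, Measure.restrict_univ]
    exact hwint.trans_lt ENNReal.one_lt_top⟩
  have hkint : ∫⁻ x, k x ∂m = 1 := by
    have := hh1
    rwa [hhm, withDensity_apply _ .univ, Measure.restrict_univ] at this
  have hkfin : ∀ᵐ x ∂m, k x < ∞ := ae_lt_top hkc.measurable (by simp [hkint])
  have hkreal : Integrable (fun x => (k x).toReal) m :=
    integrable_toReal_of_lintegral_ne_top hkc.aemeasurable (by simp [hkint])
  let Γ : X → C(U, ℝ) := fun x => ⟨fun u => G (x, u), hGc x⟩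
  have hΓ : StronglyMeasurable Γ := ContinuousMap.stronglyMeasurable_of_eval fun u =>
    hG.comp (measurable_id.prodMk measurable_const)
  have hv : Integrable (fun x => (k x).toReal • Γ x) m := by
    refine (hkreal.mul_const (max C 0)).mono'
      (hkreal.aestronglyMeasurable.smul hΓ.aestronglyMeasurable) (ae_of_all _ fun x => ?_)
    rw [norm_smul, Real.norm_of_nonneg ENNReal.toReal_nonneg]
    gcongr
    exact (ContinuousMap.norm_le _ (le_max_right _ _)).2 fun u => (hC (x, u)).trans (le_max_left _ _)
  refine continuous_of_uniform_approx_of_continuous fun V hV => ?_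
  obtain ⟨ε, hε, hεV⟩ := Metric.mem_uniformity_dist.1 hV
  -- Approximation in $L^1(m;C(U))$ controls the supremum over actions, so the error is uniform in
  -- the policy. The product $w\varphi$ is a Young test function since $\int w\,d\psi\le1$.
  obtain ⟨φ, hφ, hφint⟩ := hv.exists_boundedContinuous_integral_sub_le (half_pos hε)
  have hφc : Continuous fun q : X × U => φ q.1 q.2 :=
    ContinuousEval.continuous_eval.comp ((φ.continuous.comp continuous_fst).prodMk continuous_snd)
  have hφb : ∀ x u, |φ x u| ≤ ‖φ‖ := fun x u =>
    ((φ x).norm_coe_le_norm u).trans (φ.norm_coe_le_norm x)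
  have hwR : ∀ x, (w x).toReal ≤ 1 := fun x => ENNReal.toReal_mono (by simp) (hw1 x)
  have hwtop : ∀ x, w x ≠ ∞ := fun x => ((hw1 x).trans_lt ENNReal.one_lt_top).ne
  let g : X × U →ᵇ ℝ := BoundedContinuousFunction.ofNormedAddCommGroup
    (fun q => (w q.1).toReal * φ q.1 q.2)
    ((((ENNReal.continuousOn_toReal.comp_continuous hwc hwtop)).comp continuous_fst).mul hφc)
    ‖φ‖ fun q => by
      rw [norm_mul, Real.norm_of_nonneg ENNReal.toReal_nonneg]
      exact (mul_le_of_le_one_left (norm_nonneg _) (hwR _)).trans (hφb _ _)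
  have hg : g ∈ youngTestFunctions U ψ := by
    have hle : ∀ x, ⨆ u, ‖g (x, u)‖ₑ ≤ w x * ENNReal.ofReal ‖φ‖ := fun x => iSup_le fun u => by
      change ‖(w x).toReal * φ x u‖ₑ ≤ _
      rw [enorm_mul, Real.enorm_of_nonneg ENNReal.toReal_nonneg, ENNReal.ofReal_toReal (hwtop x),
        Real.enorm_eq_ofReal_abs]
      gcongr
      exact hφb x u
    calc ∫⁻ x, ⨆ u, ‖g (x, u)‖ₑ ∂ψ ≤ ∫⁻ x, w x * ENNReal.ofReal ‖φ‖ ∂ψ := lintegral_mono hle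
      _ = (∫⁻ x, w x ∂ψ) * ENNReal.ofReal ‖φ‖ := lintegral_mul_const _ hwc.measurable
      _ < ∞ := ENNReal.mul_lt_top (hwint.trans_lt ENNReal.one_lt_top) ENNReal.ofReal_lt_top
  refine ⟨_, continuous_integral_youngTestFunction hg, fun γ => hεV ?_⟩
  have := γ.2
  have hgm : ∫ x, ∫ u, g (x, u) ∂(γ.1 x) ∂ψ = ∫ x, ∫ u, φ x u ∂(γ.1 x) ∂m := by
    rw [hm, integral_withDensity_eq_integral_toReal_smul hwc.measurable
      (ae_of_all _ fun x => (hwtop x).lt_top)]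
    refine integral_congr_ae (ae_of_all _ fun x => ?_)
    change ∫ u, (w x).toReal * φ x u ∂(γ.1 x) = _
    exact integral_const_mul _ _
  have hGx : ∀ x, Integrable (fun u => G (x, u)) (γ.1 x) := fun x =>
    Integrable.of_bound (hGc x).aestronglyMeasurable C (ae_of_all _ fun u => hC (x, u))
  have hφx : ∀ x, Integrable (fun u => φ x u) (γ.1 x) := fun x =>
    Integrable.of_bound (φ x).continuous.aestronglyMeasurable ‖φ‖ (ae_of_all _ fun u => hφb x u)
  have hpt : ∀ x, ‖(k x).toReal • ∫ u, G (x, u) ∂(γ.1 x) - ∫ u, φ x u ∂(γ.1 x)‖ ≤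
      ‖(k x).toReal • Γ x - φ x‖ := by
    intro x
    have hkG : Integrable (fun u => (k x).toReal • G (x, u)) (γ.1 x) :=
      (hGx x).smul (k x).toReal
    rw [← integral_smul, ← integral_sub hkG (hφx x)]
    refine (norm_integral_le_of_norm_le_const (C := ‖(k x).toReal • Γ x - φ x‖)
      (ae_of_all _ fun u => ?_)).trans (by simp)
    exact ((k x).toReal • Γ x - φ x).norm_coe_le_norm u
  have hφm : Measurable fun q : X × U => φ q.1 q.2 := hφc.measurable
  have hI1 : Integrable (fun x => (k x).toReal • ∫ u, G (x, u) ∂(γ.1 x)) m := by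
    refine hv.norm.mono' (hkreal.aestronglyMeasurable.smul
      (stronglyMeasurable_integral_policy γ hG).aestronglyMeasurable) (ae_of_all _ fun x => ?_)
    rw [norm_smul, norm_smul]
    gcongr
    exact (norm_integral_le_of_norm_le_const (C := ‖Γ x‖)
      (ae_of_all _ fun u => (Γ x).norm_coe_le_norm u)).trans (by simp)
  have hI2 : Integrable (fun x => ∫ u, φ x u ∂(γ.1 x)) m :=
    Integrable.of_bound (stronglyMeasurable_integral_policy γ hφm).aestronglyMeasurable ‖φ‖
      (ae_of_all _ fun x => (norm_integral_le_of_norm_le_const (C := ‖φ‖)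
        (ae_of_all _ fun u => hφb x u)).trans (by simp))
  rw [hhm, integral_withDensity_eq_integral_toReal_smul hkc.measurable hkfin, hgm, dist_eq_norm,
    ← integral_sub hI1 hI2]
  calc _ ≤ ∫ x, ‖(k x).toReal • Γ x - φ x‖ ∂m :=
        norm_integral_le_of_norm_le (hv.sub hφint).norm (ae_of_all _ hpt)
    _ ≤ ε / 2 := hφ
    _ < ε := half_lt_self hε

end Young

/-! ### Moving integrands and the invariance equation -/

theorem tendsto_integral_sub_of_exceedsByAtMost {ι X : Type*} [MeasurableSpace X] {l : Filter ι}
    {μ : ι → Measure X} [∀ i, IsProbabilityMeasure (μ i)] {ν : Measure X} [IsProbabilityMeasure ν]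
    (h : ∀ ε : ℝ≥0∞, ε ≠ 0 → ∀ᶠ i in l, ExceedsByAtMost (μ i) ν ε) {g : ι → X → ℝ}
    (hg : ∀ i, Measurable (g i)) {C : ℝ} (hC : ∀ i x, |g i x| ≤ C) :
    Tendsto (fun i => ∫ x, g i x ∂μ i - ∫ x, g i x ∂ν) l (𝓝 0) := by
  refine Metric.tendsto_nhds.2 fun ε hε => ?_
  set δ : ℝ := ε / (2 * (|C| + 1)) with hδ
  have hδ0 : 0 < δ := by positivity
  filter_upwards [h (ENNReal.ofReal δ) (by simpa using hδ0)] with i hi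
  rw [Real.dist_eq, sub_zero]
  calc _ ≤ 2 * C * (ENNReal.ofReal δ).toReal :=
        hi.abs_integral_sub_le ENNReal.ofReal_ne_top (hg i) (hC i)
    _ = 2 * C * δ := by rw [ENNReal.toReal_ofReal hδ0.le]
    _ < 2 * (|C| + 1) * δ := by
      gcongr
      exact (le_abs_self C).trans_lt (lt_add_one _)
    _ = ε := by rw [hδ]; field_simp

section Policies

variable {X U : Type*} [MeasurableSpace X] [MeasurableSpace U] {T : Kernel (X × U) X}

theorem closedLoop_comp (T : Kernel (X × U) X) (γ : StationaryPolicy X U) (π : Measure X)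
    [SFinite π] : closedLoop T γ ∘ₘ π = T ∘ₘ (π ⊗ₘ γ.1) := by
  have := γ.2
  rw [closedLoop, Measure.compProd_eq_comp_prod, Measure.comp_assoc]

theorem invariant_invariantMeasure (hT : UniquelyInvariant T) (γ : StationaryPolicy X U) :
    Kernel.Invariant (closedLoop T γ) (invariantMeasure T hT γ : Measure X) :=
  (hT γ).exists.choose_spec

theorem comp_compProd_invariantMeasure (hT : UniquelyInvariant T) (γ : StationaryPolicy X U) :
    T ∘ₘ ((invariantMeasure T hT γ : Measure X) ⊗ₘ γ.1) = invariantMeasure T hT γ := by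
  rw [← closedLoop_comp]
  exact invariant_invariantMeasure hT γ

theorem eq_invariantMeasure (hT : UniquelyInvariant T) (γ : StationaryPolicy X U)
    (π : ProbabilityMeasure X) (hπ : Kernel.Invariant (closedLoop T γ) (π : Measure X)) :
    π = invariantMeasure T hT γ :=
  (hT γ).unique hπ (invariant_invariantMeasure hT γ)

theorem abs_integral_le_of_forall_abs_le {μ : Measure X} [IsProbabilityMeasure μ] {g : X → ℝ}
    {C : ℝ} (h : ∀ x, |g x| ≤ C) : |∫ x, g x ∂μ| ≤ C :=
  (norm_integral_le_of_norm_le_const (f := g) (C := C) (ae_of_all μ h)).trans_eq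
    (by rw [probReal_univ, mul_one])

theorem integral_comp_compProd [IsMarkovKernel T] (γ : StationaryPolicy X U) (π : Measure X)
    [IsProbabilityMeasure π] {F : X → ℝ} (hF : Measurable F) {C : ℝ} (hC : ∀ x, |F x| ≤ C) :
    ∫ y, F y ∂(T ∘ₘ (π ⊗ₘ γ.1)) = ∫ x, ∫ u, ∫ y, F y ∂(T (x, u)) ∂(γ.1 x) ∂π := by
  have := γ.2
  have hF2 : StronglyMeasurable fun q : (X × U) × X => F q.2 :=
    hF.stronglyMeasurable.comp_measurable measurable_snd
  rw [← Measure.snd_compProd, Measure.snd,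
    integral_map measurable_snd.aemeasurable hF.aestronglyMeasurable, Measure.integral_compProd
      (Integrable.of_bound hF2.aestronglyMeasurable C (ae_of_all _ fun q => hC q.2)),
    Measure.integral_compProd]
  exact Integrable.of_bound hF2.integral_kernel_prod_right'.aestronglyMeasurable C
    (ae_of_all _ fun p => abs_integral_le_of_forall_abs_le hC)

end Policies

/-! ### Tightness inside the charged set -/

section Tightness

variable {P X : Type*} [MeasurableSpace P] [MetricSpace X] [SecondCountableTopology X]
  [MeasurableSpace X] [BorelSpace X] {ψ : Measure X} {f : P → X → ℝ≥0}

theorem kernel_compl_support_inter_positivitySet {κ : Kernel P X}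
    (hκ : ∀ p, κ p = ψ.withDensity fun y => (f p y : ℝ≥0∞)) (hf : Equicontinuous f) (p : P) :
    κ p (ψ.support ∩ positivitySet f)ᶜ = 0 := by
  have hO := (isOpen_positivitySet hf).measurableSet.compl
  rw [compl_inter]
  refine measure_union_null ?_ ?_
  · rw [hκ]
    exact withDensity_absolutelyContinuous ψ _ Measure.measure_compl_support
  · rw [hκ, withDensity_apply _ hO, setLIntegral_eq_zero hO]
    intro y hy
    have : f p y = 0 := by
      by_contra hp
      exact hy ⟨p, hp⟩
    simp [this]

theorem comp_apply_eq_zero {P X : Type*} [MeasurableSpace P] [MeasurableSpace X]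
    {κ : Kernel P X} {μ : Measure P} {s : Set X} (hs : MeasurableSet s)
    (h : ∀ p, κ p s = 0) : (κ ∘ₘ μ) s = 0 := by
  rw [Measure.bind_apply hs κ.aemeasurable]
  simp [h]

/-- Inner regularity of the majorant inside the charged set gives one compact set for all laws; the
kernel gives no mass to the rest. -/
theorem exists_isCompact_comp_compl_le_of_le [ProperSpace X] {κ : Kernel P X}
    (hκ : ∀ p, κ p = ψ.withDensity fun y => (f p y : ℝ≥0∞)) (hf : Equicontinuous f)
    {ν : Measure X} [IsFiniteMeasure ν] (hν : ∀ p, κ p ≤ ν) {ε : ℝ≥0∞} (hε : ε ≠ 0) :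
    ∃ K, IsCompact K ∧ K ⊆ ψ.support ∩ positivitySet f ∧
      ∀ μ : Measure P, IsProbabilityMeasure μ → (κ ∘ₘ μ) Kᶜ ≤ ε := by
  set A := ψ.support ∩ positivitySet f with hA
  have hAm : MeasurableSet A :=
    Measure.isClosed_support.measurableSet.inter (isOpen_positivitySet hf).measurableSet
  obtain ⟨K, hKA, hK, hKε⟩ := hAm.exists_isCompact_sdiff_lt (μ := ν) (measure_ne_top _ _) hε
  refine ⟨K, hK, hKA, fun μ _ => ?_⟩
  rw [Measure.bind_apply hK.measurableSet.compl κ.aemeasurable]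
  have : ∀ p, κ p Kᶜ ≤ ε := fun p => by
    calc κ p Kᶜ ≤ κ p ((A \ K) ∪ Aᶜ) := measure_mono fun x hx => by
          by_cases hxA : x ∈ A
          · exact Or.inl ⟨hxA, hx⟩
          · exact Or.inr hxA
      _ ≤ κ p (A \ K) + κ p Aᶜ := measure_union_le _ _
      _ ≤ ν (A \ K) + 0 := add_le_add (hν p _) (kernel_compl_support_inter_positivitySet hκ hf p).le
      _ ≤ ε := by rw [add_zero]; exact hKε.le
  calc ∫⁻ p, κ p Kᶜ ∂μ ≤ ∫⁻ _, ε ∂μ := lintegral_mono this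
    _ = ε := by simp

end Tightness

/-- The limit occupation measure is again invariant, so its state marginal lives on the open
positivity set. A compact subset carrying almost all of that mass is enlarged to one whose interior
contains it, and the portmanteau inequality for open sets applies. -/
theorem exists_isCompact_compl_le_of_isCompact_invariantOccupationMeasures {X U : Type*}
    [MetricSpace X] [ProperSpace X] [MeasurableSpace X] [BorelSpace X]
    [MetricSpace U] [CompactSpace U] [MeasurableSpace U] [BorelSpace U]
    {T : Kernel (X × U) X} {ψ : Measure X} {f : X × U → X → ℝ≥0}
    (hκ : ∀ p, T p = ψ.withDensity fun y => (f p y : ℝ≥0∞)) (hf : Equicontinuous f)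
    (hcomp : IsCompact (invariantOccupationMeasures T)) {ι : Type*} (𝒰 : Ultrafilter ι)
    (μ : ι → Measure (X × U)) [∀ i, IsProbabilityMeasure (μ i)]
    (hμ : ∀ i, T ∘ₘ μ i = (μ i).fst) {ε : ℝ≥0∞} (hε : ε ≠ 0) :
    ∃ K, IsCompact K ∧ K ⊆ ψ.support ∩ positivitySet f ∧
      ∀ᶠ i in (𝒰 : Filter ι), (T ∘ₘ μ i) Kᶜ ≤ ε := by
  have hprob : ∀ i, IsProbabilityMeasure (T ∘ₘ μ i) := fun i => by
    rw [hμ]; infer_instance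
  rcases le_total 1 ε with h1 | h1
  -- Disposing of $\varepsilon\ge1$ keeps the truncated difference `1 - ε` meaningful below.
  · exact ⟨∅, isCompact_empty, empty_subset _, .of_forall fun i => prob_le_one.trans h1⟩
  let M : ι → ProbabilityMeasure (X × U) := fun i => ⟨μ i, inferInstance⟩
  have hM : ∀ i, M i ∈ invariantOccupationMeasures T := fun i B hB => by
    change μ i (B ×ˢ univ) = ∫⁻ p, T p B ∂μ i
    rw [← Measure.bind_apply hB T.aemeasurable, hμ, Measure.fst_apply hB, prod_univ]
  obtain ⟨m, hm, hmlim⟩ := hcomp.ultrafilter_le_nhds (𝒰.map M)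
    (le_principal_iff.2 (Filter.mem_map.2 (univ_mem' hM)))
  have hMm : Tendsto M 𝒰 (𝓝 m) := hmlim
  set O := positivitySet f with hO
  have hOo : IsOpen O := isOpen_positivitySet hf
  have hTO : ∀ p, T p Oᶜ = 0 := fun p =>
    measure_mono_null (compl_subset_compl.2 inter_subset_right)
      (kernel_compl_support_inter_positivitySet hκ hf p)
  have hmO : (m : Measure (X × U)).fst O = 1 := by
    have h0 : (m : Measure (X × U)).fst Oᶜ = 0 := by
      rw [Measure.fst_apply hOo.measurableSet.compl, ← prod_univ, hm _ hOo.measurableSet.compl]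
      simp [hTO]
    exact (prob_compl_eq_zero_iff hOo.measurableSet).1 h0
  obtain ⟨K₀, hK₀O, hK₀, hK₀ε⟩ := hOo.measurableSet.exists_isCompact_lt_add
    (μ := (m : Measure (X × U)).fst) (measure_ne_top _ _) hε
  obtain ⟨K, hK, hK₀K, hKO⟩ := exists_compact_between hK₀ hOo hK₀O
  have hlt : 1 - ε < (m : Measure (X × U)) (interior K ×ˢ univ) := by
    rw [hmO] at hK₀ε
    refine (ENNReal.sub_lt_of_lt_add h1 hK₀ε).trans_le ?_
    rw [prod_univ, ← Measure.fst_apply isOpen_interior.measurableSet]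
    exact measure_mono hK₀K
  have hev := eventually_lt_of_lt_liminf (hlt.trans_le
    (ProbabilityMeasure.le_liminf_measure_open_of_tendsto hMm (isOpen_interior.prod isOpen_univ)))
  refine ⟨ψ.support ∩ K, hK.inter_left Measure.isClosed_support,
    inter_subset_inter_right _ hKO, ?_⟩
  filter_upwards [hev] with i hi
  have hS : (T ∘ₘ μ i) ψ.supportᶜ = 0 :=
    comp_apply_eq_zero Measure.isClosed_support.measurableSet.compl fun p =>
      measure_mono_null (compl_subset_compl.2 inter_subset_left)
        (kernel_compl_support_inter_positivitySet hκ hf p)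
  have hi' : 1 - ε < (T ∘ₘ μ i) (interior K) := by
    rw [hμ, Measure.fst_apply isOpen_interior.measurableSet, ← prod_univ]
    exact hi
  calc (T ∘ₘ μ i) (ψ.support ∩ K)ᶜ ≤ (T ∘ₘ μ i) ψ.supportᶜ + (T ∘ₘ μ i) Kᶜ := by
        rw [compl_inter]; exact measure_union_le _ _
    _ = 1 - (T ∘ₘ μ i) K := by rw [hS, zero_add, prob_compl_eq_one_sub hK.measurableSet]
    _ ≤ ε := by
      rw [tsub_le_iff_left]
      exact tsub_le_iff_right.1 (hi'.le.trans (measure_mono interior_subset))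

/-! ### Identification of the limit -/

section Main

variable {X U : Type*} [MetricSpace X] [ProperSpace X] [MeasurableSpace X] [BorelSpace X]
  [MetricSpace U] [CompactSpace U] [MeasurableSpace U] [BorelSpace U]
  {T : Kernel (X × U) X} [IsMarkovKernel T] {ψ : Measure X} [SigmaFinite ψ]

/-- The invariant measures of nearby policies exceed that of the given policy by an arbitrarily
small mass. -/
theorem eventually_exceedsByAtMost_invariantMeasure
    (hinv : UniquelyInvariant T) (hdens : HasBoundedEquicontinuousDensities T ψ)
    (hreg : (WeaklyContinuousKernel T ∧ IsCompact (invariantOccupationMeasures T)) ∨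
      (StronglyContinuousInAction T ∧ MajorizedKernel T))
    (γ : StationaryPolicy X U) {ε : ℝ≥0∞} (hε : ε ≠ 0) :
    ∀ᶠ γ' in @nhds _ (youngTopology U ψ) γ,
      ExceedsByAtMost (invariantMeasure T hinv γ' : Measure X) (invariantMeasure T hinv γ) ε := by
  let _ := youngTopology (X := X) U ψ
  refine mem_iff_ultrafilter.2 fun 𝒰 h𝒰 => ?_
  obtain ⟨f, hTf, -, hf⟩ := hdens
  have hκ : ∀ p : X × U, T p = ψ.withDensity fun y => (f p.1 p.2 y : ℝ≥0∞) := fun p => hTf p.1 p.2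
  let π : StationaryPolicy X U → Measure X := fun γ' => invariantMeasure T hinv γ'
  have hmarkov : ∀ γ' : StationaryPolicy X U, IsMarkovKernel γ'.1 := fun γ' => γ'.2
  have hπ : ∀ γ', T ∘ₘ (π γ' ⊗ₘ γ'.1) = π γ' := comp_compProd_invariantMeasure hinv
  have tight : ∀ ε : ℝ≥0∞, ε ≠ 0 → ∃ K, IsCompact K ∧
      K ⊆ ψ.support ∩ positivitySet (fun p : X × U => f p.1 p.2) ∧
      ∀ᶠ γ' in (𝒰 : Filter (StationaryPolicy X U)), (T ∘ₘ (π γ' ⊗ₘ γ'.1)) Kᶜ ≤ ε := by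
    intro ε hε
    rcases hreg with ⟨-, hcomp⟩ | ⟨-, ν, hνfin, hν⟩
    · exact exists_isCompact_compl_le_of_isCompact_invariantOccupationMeasures hκ hf hcomp 𝒰
        (fun γ' => π γ' ⊗ₘ γ'.1) (fun γ' => by rw [hπ, Measure.fst_compProd]) hε
    · obtain ⟨K, hK, hKs, hKε⟩ :=
        exists_isCompact_comp_compl_le_of_le hκ hf (fun p => hν p.1 p.2) hε
      exact ⟨K, hK, hKs, .of_forall fun γ' => hKε _ inferInstance⟩
  obtain ⟨h, hh, hh1, hex⟩ := exists_limit_density 𝒰 T hκ hf (fun γ' => π γ' ⊗ₘ γ'.1) tight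
  simp only [hπ] at hex
  have hprob : IsProbabilityMeasure (ψ.withDensity h) := ⟨hh1⟩
  have hlim : Kernel.Invariant (closedLoop T γ) (ψ.withDensity h) := by
    change closedLoop T γ ∘ₘ ψ.withDensity h = ψ.withDensity h
    rw [closedLoop_comp]
    refine (ext_of_forall_integral_eq_of_IsFiniteMeasure fun F => ?_).symm
    set G : X × U → ℝ := fun q => ∫ y, F y ∂(T q)
    have hFb : ∀ y, |F y| ≤ ‖F‖ := F.norm_coe_le_norm
    have hFm : Measurable F := F.continuous.measurable
    have hGm : Measurable G :=
      (hFm.stronglyMeasurable.comp_measurable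
        measurable_snd).integral_kernel_prod_right'.measurable
    have hGb : ∀ q, |G q| ≤ ‖F‖ := fun q => abs_integral_le_of_forall_abs_le hFb
    -- Continuity in the action alone is enough, and both alternatives provide it.
    have hGc : ∀ x, Continuous fun u => G (x, u) := by
      intro x
      rcases hreg with ⟨hweak, -⟩ | ⟨hstrong, -⟩
      · exact (hweak F).comp (by fun_prop)
      · exact hstrong x F hFm ⟨‖F‖, hFb⟩
    have hGγb : ∀ (γ' : StationaryPolicy X U) x, |∫ u, G (x, u) ∂(γ'.1 x)| ≤ ‖F‖ := fun γ' x =>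
      abs_integral_le_of_forall_abs_le fun u => hGb (x, u)
    have t1 := tendsto_integral_sub_of_exceedsByAtMost hex (g := fun _ => F) (fun _ => hFm)
      (fun _ => hFb)
    have t2 := tendsto_integral_sub_of_exceedsByAtMost hex
      (g := fun γ' x => ∫ u, G (x, u) ∂(γ'.1 x))
      (fun γ' => (stronglyMeasurable_integral_policy γ' hGm).measurable) hGγb
    have t3 : Tendsto (fun γ' : StationaryPolicy X U =>
        ∫ x, ∫ u, G (x, u) ∂(γ'.1 x) ∂(ψ.withDensity h)) 𝒰
        (𝓝 (∫ x, ∫ u, G (x, u) ∂(γ.1 x) ∂(ψ.withDensity h))) :=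
      ((continuous_integral_withDensity_policy hh hh1 hGm hGc hGb).tendsto γ).mono_left h𝒰
    have heq : ∀ γ', ∫ x, ∫ u, G (x, u) ∂(γ'.1 x) ∂(π γ') = ∫ y, F y ∂(π γ') := fun γ' => by
      conv_rhs => rw [← hπ γ', integral_comp_compProd γ' (π γ') hFm hFb]
    rw [integral_comp_compProd γ _ hFm hFb]
    -- By invariance the integrals against `π γ'` cancel, leaving the constant $\int F\,h\,d\psi$,
    -- which must therefore equal the limit in `t3`.
    have t4 := (t2.sub t1).add t3
    simp only [heq, sub_zero, zero_add] at t4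
    exact tendsto_nhds_unique (tendsto_const_nhds.congr fun γ' => by ring) t4
  have hγ := eq_invariantMeasure hinv γ ⟨ψ.withDensity h, hprob⟩ hlim
  rw [← hγ]
  exact hex ε hε

end Main

theorem theorem4p1 {n : ℕ} {U : Type*} [MetricSpace U] [CompactSpace U]
    [MeasurableSpace U] [BorelSpace U]
    (T : Kernel (EuclideanSpace ℝ (Fin n) × U) (EuclideanSpace ℝ (Fin n))) [IsMarkovKernel T]
    (ψ : Measure (EuclideanSpace ℝ (Fin n))) [SigmaFinite ψ]
    (hinv : UniquelyInvariant T)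
    (hdens : HasBoundedEquicontinuousDensities T ψ)
    (hreg : (WeaklyContinuousKernel T ∧ IsCompact (invariantOccupationMeasures T)) ∨
      (StronglyContinuousInAction T ∧ MajorizedKernel T)) :
    Continuous[youngTopology U ψ, inferInstance] (invariantMeasure T hinv) ∧
    ∀ γ : StationaryPolicy (EuclideanSpace ℝ (Fin n)) U,
      Tendsto (fun γ' => tvDistance (invariantMeasure T hinv γ') (invariantMeasure T hinv γ))
        (@nhds _ (youngTopology U ψ) γ) (𝓝 0) := by
  let _ := youngTopology (X := EuclideanSpace ℝ (Fin n)) U ψ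
  have hex := fun γ (ε : ℝ≥0∞) (hε : ε ≠ 0) =>
    eventually_exceedsByAtMost_invariantMeasure hinv hdens hreg γ hε
  refine ⟨continuous_iff_continuousAt.2 fun γ => ?_, fun γ => ?_⟩
  · refine ProbabilityMeasure.tendsto_iff_forall_integral_tendsto.2 fun F => ?_
    exact tendsto_sub_nhds_zero_iff.1 (tendsto_integral_sub_of_exceedsByAtMost (hex γ)
      (g := fun _ => F) (fun _ => F.continuous.measurable) (fun _ => F.norm_coe_le_norm))
  · refine ENNReal.tendsto_nhds_zero.2 fun ε hε => ?_
    -- The minimum with one keeps the tolerance finite; the half absorbs the factor two in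
    -- `tvDistance_le`.
    have hε' : min ε 1 / 2 ≠ 0 := (ENNReal.div_pos (lt_min hε one_pos).ne' (by simp)).ne'
    filter_upwards [hex γ _ hε'] with γ' hγ'
    have hfin : min ε 1 / 2 ≠ ∞ :=
      ENNReal.div_ne_top ((min_le_right _ _).trans_lt ENNReal.one_lt_top).ne (by simp)
    calc _ ≤ 2 * (min ε 1 / 2) := hγ'.tvDistance_le hfin
      _ = min ε 1 := ENNReal.mul_div_cancel (by simp) (by simp)
      _ ≤ ε := min_le_left _ _
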